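/- Consider the following two-period game of a team of $N=2$ players. The technology type is $\omega\in\{R,r\}$ with $0<r<R$ and $4R<1$; player $i$ has prior $p^i=\Pr(\omega=R)\in[0,1]$, and priors are common knowledge. In period $t=1,2$ players simultaneously choose efforts $e^i_t\ge 0$ at cost $\frac12(e^i_t)^2$; the period's output is $y_t=\omega$ with probability $P(e_t)=\min\{e_t,1\}$, where $e_t=\sum_i e^i_t$, and $y_t=0$ otherwise, independently across periods given efforts and independently of $\omega$. Each player's period payoff is $\alpha y_t-\frac12(e^i_t)^2$ with $\alpha\in(0,1]$, and second-period payoffs are discounted by $\beta\in(0,1]$. If $y_1>0$ all second-period beliefs become $\pi^i=\mathbb 1(y_1=R)$; if $y_1=0$ then $\pi^i=p^i$. An equilibrium is a profile of effort rules $s^i_t:[0,1]^2\to[0,\infty)$ such that, for every $\pi\in[0,1]^2$, $s^i_2(\pi)$ maximizes $i$'s expected second-period payoff given $s_2^{-i}$, and, for every $p\in[0,1]^2$, $s^i_1(p)$ maximizes $i$'s expected discounted total payoff given $s_1^{-i}$ and $s_2$. For a manager's prior $p^\star\in[0,1]$ let $$\mathcal Y_{p^\star}(p)=\mathbb E_{p^\star}\Big[\omega\sum_{i}\big(s_1^i(p)+\beta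 s_2^i(\pi)\big)\Big]$$ be the expected output of team $p=(p^1,p^2)$ at the equilibrium $s$. A workforce is a probability distribution with continuous distribution function $F$ and support $[0,1]$; it is symmetric if $1-p\sim F$ whenever $p\sim F$. Let $T_F(p)=F^{-1}(1-F(p))$, $$\mathcal V_{p^\star}(F)=\tfrac12\int_{[0,1]}\mathcal Y_{p^\star}(p,T_F(p))\,dF(p),\qquad \bar{\mathcal D}(F)=\mathbb E[(p-p')^2]\ \text{ for independent } p,p'\sim F.$$ With $\tilde\omega=\alpha\omega$, $\Delta=\alpha(R-r)$ and $\mathbb E_q,\mathrm{Var}_q$ computed for $\Pr(\omega=R)=q$, let $$\kappa=\Big[\mathbb E_{p^\star}[\tilde\omega]+2\beta\,\mathbb E_{p^\star}[\tilde\omega]\big(\mathbb E_{p^\star}[\tilde\omega]-\mathbb E_{1/2}[\tilde\omega]\big)+2\beta\,\mathrm{Var}_{p^\star}(\tilde\omega)\Big]\frac{\beta\Delta^2}{4\alpha}.$$ Then an equilibrium exists, $\kappa>0$, and at every equilibrium the following hold. For every symmetric workforce $F$, $\mathcal V_{p^\star}(F)$ is the value of the optimal matching problem, i.e. the maximum (attained)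 of $\frac12\int\mathcal Y_{p^\star}(p,p')\,d\gamma(p,p')$ over all joint probability measures $\gamma$ with both marginals $F$. For all symmetric workforces $F,G$, $$\mathcal V_{p^\star}(F)-\mathcal V_{p^\star}(G)=\kappa\,\big(\bar{\mathcal D}(F)-\bar{\mathcal D}(G)\big),$$ and hence $\mathcal V_{p^\star}(F)>\mathcal V_{p^\star}(G)$ if and only if $\bar{\mathcal D}(F)>\bar{\mathcal D}(G)$. -/

import Mathlib

open MeasureTheory

namespace TeamProduction

/-- The parameters of the two-period production game: the high return `R`, the low return `r`,
the share `α` of output that accrues to each member, and the discount factor `β`. -/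
structure Game where
  R : ℝ
  r : ℝ
  α : ℝ
  β : ℝ

/-- The type of the technology: high return or low return. -/
inductive Tech
  | high
  | low

namespace Game

/-- The return `ω` of a technology. -/
def ret (g : Game) : Tech → ℝ
  | .high => g.R
  | .low => g.r

end Game

/-- Expectation of `f ω` when `ω` is of the high-return type with probability `q`. -/
def techExp (q : ℝ) (f : Tech → ℝ) : ℝ :=
  q * f .high + (1 - q) * f .low

/-- The probability `min {e, 1}` that aggregate effort `e` is successful. -/
def succProb (e : ℝ) : ℝ := min e 1

/-- The quadratic effort cost. -/
noncomputable def cost (e : ℝ) : ℝ := e ^ 2 / 2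

/-- Expectation of `f ω b`, where `ω` is of the high-return type with probability `q`, and,
independently, the first period is successful (`b = true`) with probability `min {e, 1}`. -/
def outcomeExp (q e : ℝ) (f : Tech → Bool → ℝ) : ℝ :=
  succProb e * techExp q (fun ω => f ω true) + (1 - succProb e) * techExp q (fun ω => f ω false)

/-- The belief profile at the beginning of the second period: a success reveals the technology to
everybody, and after a failure the players keep their priors. -/
def posterior {N : ℕ} (p : Fin N → ℝ) : Tech → Bool → Fin N → ℝ
  | .high, true => fun _ => 1
  | .low, true => fun _ => 0
  | _, false => p

/-- The belief profiles `[0,1]^N`. -/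
def beliefs (N : ℕ) : Set (Fin N → ℝ) := {p | ∀ i, p i ∈ Set.Icc (0 : ℝ) 1}

/-- A profile of effort rules for the two periods; only the values at belief profiles in `[0,1]^N`
are relevant. -/
structure Profile (N : ℕ) where
  first : Fin N → (Fin N → ℝ) → ℝ
  second : Fin N → (Fin N → ℝ) → ℝ

namespace Game

/-- Expected second-period payoff of player `i` with beliefs `π` who exerts effort `e` when her
coworkers follow `s`. -/
noncomputable def payoff₂ (g : Game) {N : ℕ} (s : Profile N) (i : Fin N) (π : Fin N → ℝ)
    (e : ℝ) : ℝ :=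
  g.α * techExp (π i) g.ret * succProb (e + ∑ j ∈ Finset.univ.erase i, s.second j π) - cost e

/-- The second-period value of player `i` at beliefs `π`, when everybody follows `s`. -/
noncomputable def contValue (g : Game) {N : ℕ} (s : Profile N) (i : Fin N) (π : Fin N → ℝ) : ℝ :=
  g.α * techExp (π i) g.ret * succProb (∑ j, s.second j π) - cost (s.second i π)

/-- Present value of the payoffs of player `i` who exerts effort `e` in the first period, at prior
profile `p`, when her coworkers follow `s` and second-period efforts are given by `s`. -/
noncomputable def payoff₁ (g : Game) {N : ℕ} (s : Profile N) (i : Fin N) (p : Fin N → ℝ)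
    (e : ℝ) : ℝ :=
  let E := e + ∑ j ∈ Finset.univ.erase i, s.first j p
  g.α * techExp (p i) g.ret * succProb E - cost e
    + g.β * outcomeExp (p i) E (fun ω b => g.contValue s i (posterior p ω b))

/-- Markov perfect equilibrium in pure strategies. -/
structure IsEquilibrium (g : Game) {N : ℕ} (s : Profile N) : Prop where
  first_nonneg : ∀ i, ∀ p ∈ beliefs N, 0 ≤ s.first i p
  second_nonneg : ∀ i, ∀ π ∈ beliefs N, 0 ≤ s.second i π
  second_optimal : ∀ i, ∀ π ∈ beliefs N, IsMaxOn (g.payoff₂ s i π) (Set.Ici 0) (s.second i π)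
  first_optimal : ∀ i, ∀ p ∈ beliefs N, IsMaxOn (g.payoff₁ s i p) (Set.Ici 0) (s.first i p)

/-- Expected aggregate (discounted) output of a team of type `p` that follows `s`, evaluated at the
manager's prior `pm`. -/
noncomputable def output (g : Game) {N : ℕ} (s : Profile N) (pm : ℝ) (p : Fin N → ℝ) : ℝ :=
  outcomeExp pm (∑ i, s.first i p) (fun ω b =>
    g.ret ω * ∑ i, (s.first i p + g.β * s.second i (posterior p ω b)))

/-- The return `α ω` accruing to each team member. -/
def memberRet (g : Game) (ω : Tech) : ℝ := g.α * g.ret ω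

/-- The coefficient of the disagreement dividend for teams of `N` members whose average optimism is
`o`, at the manager's prior `pm`. -/
noncomputable def dividendCoeff (g : Game) (N : ℕ) (o pm : ℝ) : ℝ :=
  let m := techExp pm g.memberRet
  let v := techExp pm (fun ω => (g.memberRet ω - m) ^ 2)
  (m + N * g.β * m * (m - techExp o g.memberRet) + N * g.β * v)
    * (g.β * (g.memberRet .high - g.memberRet .low) ^ 2 * (N - 1) / (4 * g.α))

end Game

/-- A workforce whose beliefs have a continuous distribution function, have support `[0,1]`, and are
distributed symmetrically (around the midpoint `1/2`). -/
structure IsSymmetricWorkforce (F : Measure ℝ) : Prop where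
  prob : IsProbabilityMeasure F
  continuous_cdf : Continuous (ProbabilityTheory.cdf F)
  support_eq : F.support = Set.Icc 0 1
  symmetric : F.map (fun p => 1 - p) = F

/-- The joint probability measures with both marginals equal to `F`. -/
def couplings (F : Measure ℝ) : Set (Measure (ℝ × ℝ)) :=
  {γ | IsProbabilityMeasure γ ∧ γ.map Prod.fst = F ∧ γ.map Prod.snd = F}

/-- The inverse (quantile function) of the distribution function of `F` on `[0,1]`. -/
noncomputable def quantile (F : Measure ℝ) (q : ℝ) : ℝ :=
  sInf {x | x ∈ Set.Icc (0 : ℝ) 1 ∧ q ≤ ProbabilityTheory.cdf F x}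

/-- The negative assortative team formation plan `T_F(p) = F⁻¹(1 - F(p))`. -/
noncomputable def plan (F : Measure ℝ) (p : ℝ) : ℝ :=
  quantile F (1 - ProbabilityTheory.cdf F p)

namespace Game

/-- The manager's objective: the aggregate expected output under the matching `γ`. -/
noncomputable def matchingOutput (g : Game) (s : Profile 2) (pm : ℝ) (γ : Measure (ℝ × ℝ)) : ℝ :=
  1 / 2 * ∫ z, g.output s pm ![z.1, z.2] ∂γ

/-- The value of workforce `F`: the aggregate expected output when types `p` and `T_F(p)` are
matched. -/
noncomputable def workforceValue (g : Game) (s : Profile 2) (pm : ℝ) (F : Measure ℝ) : ℝ :=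
  1 / 2 * ∫ p, g.output s pm ![p, plan F p] ∂F

end Game

/-- Workforce disagreement: the expectation of `(p - p')²` for independent draws `p`, `p'`. -/
noncomputable def workforceDisagreement (F : Measure ℝ) : ℝ :=
  ∫ z : ℝ × ℝ, (z.1 - z.2) ^ 2 ∂(F.prod F)

end TeamProduction

/-! Since every return is below 1/4, success is never sure in equilibrium, and each player's effort
equals her marginal benefit of success in both periods (`second_eq`, `first_eq`). On the unit square
equilibrium output is therefore an explicit symmetric cubic (`output_eq`).

Its cross terms xy and x²y + xy² depend only on x + y up to separable terms, so output is φ(x) +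
φ(y) − L(x + y), where L ≥ 0 on the relevant range and L(1) = 0 (`teamOutput_eq_potential`,
`mismatchLoss_nonneg`). Thus φ is a Kantorovich dual potential, and the coupling p ↦ (p, 1 − p),
feasible by symmetry, is optimal. It is also the plan T_F (`plan_eq`).

On x + y = 1 output is affine in (x − y)², so the workforce value is affine in E[p²], hence in
workforce disagreement, with slope κ. -/

open MeasureTheory

namespace TeamProduction

/-! ### Best responses with linear benefits and quadratic costs -/

section Contest

/-- With linear benefits of success, no best response exceeds the marginal benefit. -/
theorem effort_le_of_isMaxOn {a b c x : ℝ} (ha : 0 ≤ a)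
    (hx : IsMaxOn (fun e => a * succProb (e + c) - cost e + b) (Set.Ici 0) x) : x ≤ a := by
  by_contra! hlt
  have h := hx (Set.mem_Ici.2 ha)
  simp only [succProb, cost, Set.mem_ofPred_eq] at h
  -- Raising effort from a to x adds at most x − a to the success probability, so the payoff would
  -- fall by at least (x − a)²/2.
  have h1 : min (x + c) 1 ≤ min (a + c) 1 + (x - a) := by
    rcases min_choice (a + c) 1 with h | h <;> rw [h]
    · linarith [min_le_left (x + c) 1]
    · linarith [min_le_right (x + c) 1]
  nlinarith [mul_le_mul_of_nonneg_left h1 ha, mul_pos (sub_pos.2 hlt) (sub_pos.2 hlt)]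

/-- The payoff lies below the parabola with P(e) replaced by e. The two agree at a, the parabola's
unique maximizer. -/
theorem effort_eq_of_isMaxOn {a b c x : ℝ} (ha : 0 ≤ a) (hac : a + c ≤ 1)
    (hx : IsMaxOn (fun e => a * succProb (e + c) - cost e + b) (Set.Ici 0) x) : x = a := by
  have h := hx (Set.mem_Ici.2 ha)
  simp only [succProb, cost, Set.mem_ofPred_eq] at h
  rw [min_eq_left hac] at h
  have h1 := mul_le_mul_of_nonneg_left (min_le_left (x + c) 1) ha
  have h2 : (x - a) ^ 2 = 0 := le_antisymm (by nlinarith) (sq_nonneg _)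
  exact sub_eq_zero.1 (pow_eq_zero_iff two_ne_zero |>.1 h2)

theorem isMaxOn_effort {a b c : ℝ} (ha : 0 ≤ a) (hac : a + c ≤ 1) :
    IsMaxOn (fun e => a * succProb (e + c) - cost e + b) (Set.Ici 0) a := by
  intro x _
  simp only [succProb, cost, Set.mem_ofPred_eq]
  rw [min_eq_left hac]
  nlinarith [mul_le_mul_of_nonneg_left (min_le_left (x + c) 1) ha, sq_nonneg (x - a)]

theorem add_sum_erase_univ {N : ℕ} (f : Fin N → ℝ) (i : Fin N) :
    f i + ∑ j ∈ Finset.univ.erase i, f j = ∑ j, f j :=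
  Finset.add_sum_erase _ _ (Finset.mem_univ i)

/-- With linear benefits of success, mutually optimal efforts equal the marginal benefits, as long
as these are too small for sure success. -/
theorem efforts_eq_of_isMaxOn {N : ℕ} {a b e : Fin N → ℝ} (ha : ∀ i, 0 ≤ a i)
    (hsum : ∑ i, a i ≤ 1)
    (he : ∀ i, IsMaxOn (fun x => a i * succProb (x + ∑ j ∈ Finset.univ.erase i, e j) - cost x + b i)
      (Set.Ici 0) (e i)) (i : Fin N) : e i = a i := by
  refine effort_eq_of_isMaxOn (ha i) ?_ (he i)
  -- The a priori bound on the coworkers' efforts keeps the deviation to `a i` below the kink of P.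
  have := Finset.sum_le_sum (s := Finset.univ.erase i)
    fun j _ => effort_le_of_isMaxOn (ha j) (he j)
  linarith [add_sum_erase_univ a i]

end Contest

/-! ### Existence and uniqueness of equilibrium efforts -/

namespace Game

/-- The second-period marginal benefit of success of a player with belief `q`. -/
def meanRet (g : Game) (q : ℝ) : ℝ := g.α * techExp q g.ret

/-- The first-period marginal benefit of success of a player, including the option value of
learning the technology. -/
noncomputable def successGain (g : Game) {N : ℕ} (p : Fin N → ℝ) (i : Fin N) : ℝ :=
  g.meanRet (p i) + g.β * ((N - 1 / 2) * techExp (p i) (fun ω => g.memberRet ω ^ 2) -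
    (g.meanRet (p i) * ∑ j, g.meanRet (p j) - g.meanRet (p i) ^ 2 / 2))

theorem meanRet_zero (g : Game) : g.meanRet 0 = g.memberRet .low := by
  simp [meanRet, memberRet, techExp]

theorem meanRet_one (g : Game) : g.meanRet 1 = g.memberRet .high := by
  simp [meanRet, memberRet, techExp]

/-- The profile in which every effort equals the marginal benefit of success. -/
noncomputable def marginalProfile (g : Game) (N : ℕ) : Profile N where
  first i p := g.successGain p i
  second i π := g.meanRet (π i)

theorem posterior_mem_beliefs {N : ℕ} {p : Fin N → ℝ} (hp : p ∈ beliefs N) (ω : Tech) (b : Bool) :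
    posterior p ω b ∈ beliefs N := by
  cases ω <;> cases b <;> first | exact hp | (intro i; simp [posterior])

/-- Positive returns, shares and discount factors, and returns so low that success is never sure. -/
structure IsAdmissible (g : Game) : Prop where
  low_pos : 0 < g.r
  low_lt_high : g.r < g.R
  share_pos : 0 < g.α
  share_le_one : g.α ≤ 1
  discount_pos : 0 < g.β
  discount_le_one : g.β ≤ 1
  four_mul_high_lt_one : 2 * 2 * g.R < 1

namespace IsAdmissible

variable {g : Game}

theorem memberRet_low_pos (hg : g.IsAdmissible) : 0 < g.memberRet .low :=
  mul_pos hg.share_pos hg.low_pos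

theorem memberRet_low_lt_high (hg : g.IsAdmissible) : g.memberRet .low < g.memberRet .high :=
  mul_lt_mul_of_pos_left hg.low_lt_high hg.share_pos

theorem memberRet_high_lt (hg : g.IsAdmissible) : g.memberRet .high < 1 / 4 := by
  have h1 : g.R < 1 / 4 := by linarith [hg.four_mul_high_lt_one]
  have h2 : g.α * g.R ≤ 1 * g.R :=
    mul_le_mul_of_nonneg_right hg.share_le_one (hg.low_pos.trans hg.low_lt_high).le
  simp only [memberRet, ret]
  linarith

theorem meanRet_eq (g : Game) (q : ℝ) :
    g.meanRet q = g.memberRet .low + q * (g.memberRet .high - g.memberRet .low) := by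
  simp only [meanRet, techExp, memberRet]
  ring

theorem meanRet_pos (hg : g.IsAdmissible) {q : ℝ} (hq : q ∈ Set.Icc (0 : ℝ) 1) :
    0 < g.meanRet q := by
  rw [meanRet_eq]
  linarith [hg.memberRet_low_pos, mul_nonneg hq.1 (sub_nonneg.2 hg.memberRet_low_lt_high.le)]

theorem meanRet_lt (hg : g.IsAdmissible) {q : ℝ} (hq : q ∈ Set.Icc (0 : ℝ) 1) :
    g.meanRet q < 1 / 4 := by
  rw [meanRet_eq]
  linarith [hg.memberRet_high_lt,
    mul_le_mul_of_nonneg_right hq.2 (sub_nonneg.2 hg.memberRet_low_lt_high.le)]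

theorem sum_meanRet_le (hg : g.IsAdmissible) {π : Fin 2 → ℝ} (hπ : π ∈ beliefs 2) :
    ∑ i, g.meanRet (π i) ≤ 1 := by
  rw [Fin.sum_univ_two]
  linarith [hg.meanRet_lt (hπ 0), hg.meanRet_lt (hπ 1)]

theorem sq_meanRet_le_techExp_sq {q : ℝ} (hq : q ∈ Set.Icc (0 : ℝ) 1) :
    g.meanRet q ^ 2 ≤ techExp q (fun ω => g.memberRet ω ^ 2) := by
  have h := mul_nonneg (mul_nonneg hq.1 (sub_nonneg.2 hq.2))
    (sq_nonneg (g.memberRet .high - g.memberRet .low))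
  rw [meanRet_eq]
  simp only [techExp]
  nlinarith

theorem techExp_sq_le (hg : g.IsAdmissible) {q : ℝ} (hq : q ∈ Set.Icc (0 : ℝ) 1) :
    techExp q (fun ω => g.memberRet ω ^ 2) ≤ 1 / 16 := by
  have h0 := hg.memberRet_low_pos
  have h1 := hg.memberRet_low_lt_high
  have h2 : g.memberRet .high ^ 2 ≤ 1 / 16 := by nlinarith [hg.memberRet_high_lt]
  have h3 : g.memberRet .low ^ 2 ≤ 1 / 16 := by nlinarith [hg.memberRet_high_lt]
  simp only [techExp]
  nlinarith [mul_le_mul_of_nonneg_left h2 hq.1,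
    mul_le_mul_of_nonneg_left h3 (sub_nonneg.2 hq.2)]

/-- The bound 1/2 makes two gains sum to at most 1, so success is not capped in the first period
either. -/
theorem successGain_nonneg_and_le (hg : g.IsAdmissible) {p : Fin 2 → ℝ} (hp : p ∈ beliefs 2)
    (i : Fin 2) : 0 ≤ g.successGain p i ∧ g.successGain p i ≤ 1 / 2 := by
  have hpos := fun j => hg.meanRet_pos (hp j)
  have hlt := fun j => hg.meanRet_lt (hp j)
  have hsq := sq_meanRet_le_techExp_sq (g := g) (hp i)
  have hle := hg.techExp_sq_le (hp i)
  have hb := hg.discount_pos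
  have hb1 := hg.discount_le_one
  simp only [successGain, Fin.sum_univ_two]
  set v := techExp (p i) (fun ω => g.memberRet ω ^ 2)
  have hv : 0 ≤ v := (sq_nonneg _).trans hsq
  set m := g.meanRet (p i) with hm
  set S := g.meanRet (p 0) + g.meanRet (p 1) with hS
  have hmS : m ≤ S := by
    fin_cases i <;> simp only [hm, hS, Fin.zero_eta, Fin.mk_one] <;>
      linarith [hpos 0, hpos 1]
  have hS2 : S ≤ 1 / 2 := by linarith [hlt 0, hlt 1]
  have hm0 := hpos i
  have hm1 := hlt i
  rw [← hm] at hm0 hm1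
  have hmS' : m * S ≤ m * (1 / 2) := mul_le_mul_of_nonneg_left hS2 hm0.le
  have hmS'' : m * m ≤ m * S := mul_le_mul_of_nonneg_left hmS hm0.le
  push_cast
  constructor
  -- A negative option value costs at most half the current benefit m, as S ≤ 1/2.
  · have : -(m / 2) ≤ (2 - 1 / 2) * v - (m * S - m ^ 2 / 2) := by nlinarith
    nlinarith
  · have : (2 - 1 / 2) * v - (m * S - m ^ 2 / 2) ≤ 3 / 32 := by nlinarith
    nlinarith

theorem sum_successGain_le (hg : g.IsAdmissible) {p : Fin 2 → ℝ} (hp : p ∈ beliefs 2) :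
    ∑ i, g.successGain p i ≤ 1 := by
  rw [Fin.sum_univ_two]
  linarith [(hg.successGain_nonneg_and_le hp 0).2, (hg.successGain_nonneg_and_le hp 1).2]

theorem contValue_eq (hg : g.IsAdmissible) {s : Profile 2}
    (hs : ∀ i, ∀ π ∈ beliefs 2, s.second i π = g.meanRet (π i)) {π : Fin 2 → ℝ}
    (hπ : π ∈ beliefs 2) (i : Fin 2) :
    g.contValue s i π = g.meanRet (π i) * ∑ j, g.meanRet (π j) - g.meanRet (π i) ^ 2 / 2 := by
  have h : ∑ j, s.second j π = ∑ j, g.meanRet (π j) := Finset.sum_congr rfl fun j _ => hs j π hπ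
  rw [contValue, h, hs i π hπ, succProb, min_eq_left (hg.sum_meanRet_le hπ), cost]
  rfl

/-- After a success all efforts equal ω̃, leaving each player 2ω̃² − ω̃²/2; after a failure priors
are kept. The continuation is thus affine in the success probability, which reduces the first period
to the linear contest. Only second-period efforts are assumed, so this serves both existence and
uniqueness. -/
theorem payoff₁_eq (hg : g.IsAdmissible) {s : Profile 2}
    (hs : ∀ i, ∀ π ∈ beliefs 2, s.second i π = g.meanRet (π i)) {p : Fin 2 → ℝ}
    (hp : p ∈ beliefs 2) (i : Fin 2) :
    g.payoff₁ s i p = fun e =>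
      g.successGain p i * succProb (e + ∑ j ∈ Finset.univ.erase i, s.first j p) - cost e +
        g.β * g.contValue s i p := by
  have hH := hg.contValue_eq hs (posterior_mem_beliefs hp .high true) i
  have hL := hg.contValue_eq hs (posterior_mem_beliefs hp .low true) i
  simp only [posterior, meanRet_one, meanRet_zero, Fin.sum_univ_two] at hH hL
  funext e
  simp only [payoff₁, successGain, outcomeExp, techExp]
  rw [show posterior p .high false = p from rfl, show posterior p .low false = p from rfl]
  simp only [posterior, hH, hL, hg.contValue_eq hs hp i]
  rw [show g.α * (p i * g.ret .high + (1 - p i) * g.ret .low) = g.meanRet (p i) from rfl]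
  push_cast
  ring

theorem isEquilibrium_marginalProfile (hg : g.IsAdmissible) :
    g.IsEquilibrium (g.marginalProfile 2) where
  first_nonneg i p hp := (hg.successGain_nonneg_and_le hp i).1
  second_nonneg i π hπ := (hg.meanRet_pos (hπ i)).le
  second_optimal i π hπ := by
    have h := isMaxOn_effort (b := 0) (c := ∑ j ∈ Finset.univ.erase i, g.meanRet (π j))
      (hg.meanRet_pos (hπ i)).le
      ((add_sum_erase_univ (fun j => g.meanRet (π j)) i).trans_le (hg.sum_meanRet_le hπ))
    simpa only [add_zero] using! h
  first_optimal i p hp := by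
    rw [hg.payoff₁_eq (fun _ _ _ => rfl) hp i]
    exact isMaxOn_effort (hg.successGain_nonneg_and_le hp i).1
      ((add_sum_erase_univ (fun j => g.successGain p j) i).trans_le (hg.sum_successGain_le hp))

theorem second_eq (hg : g.IsAdmissible) {s : Profile 2} (hs : g.IsEquilibrium s) (i : Fin 2)
    {π : Fin 2 → ℝ} (hπ : π ∈ beliefs 2) : s.second i π = g.meanRet (π i) :=
  efforts_eq_of_isMaxOn (e := fun j => s.second j π) (b := 0)
    (fun j => (hg.meanRet_pos (hπ j)).le) (hg.sum_meanRet_le hπ)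
    (fun j => by simpa only [Pi.zero_apply, add_zero] using! hs.second_optimal j π hπ) i

theorem first_eq (hg : g.IsAdmissible) {s : Profile 2} (hs : g.IsEquilibrium s) (i : Fin 2)
    {p : Fin 2 → ℝ} (hp : p ∈ beliefs 2) : s.first i p = g.successGain p i :=
  efforts_eq_of_isMaxOn (e := fun j => s.first j p)
    (b := fun j => g.β * g.contValue s j p)
    (fun j => (hg.successGain_nonneg_and_le hp j).1) (hg.sum_successGain_le hp)
    (fun j => by
      rw [← hg.payoff₁_eq (fun i π hπ => hg.second_eq hs i hπ) hp j]
      exact hs.first_optimal j p hp) i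

end IsAdmissible

/-! ### Equilibrium output and its dual decomposition -/

/-- The first-period aggregate effort of a team with priors `x` and `y`. -/
noncomputable def teamEffort (g : Game) (x y : ℝ) : ℝ :=
  let Δ := g.memberRet .high - g.memberRet .low
  2 * g.memberRet .low + Δ * (x + y)
    + g.β * Δ ^ 2 * ((x - y) ^ 2 + 3 / 2 * (x * (1 - x) + y * (1 - y)))

/-- The expected equilibrium output of a team with priors `x` and `y`. -/
noncomputable def teamOutput (g : Game) (pm x y : ℝ) : ℝ :=
  let M := 2 * g.memberRet .low + (g.memberRet .high - g.memberRet .low) * (x + y)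
  let w := techExp pm g.ret
  g.teamEffort x y * (w + 2 * g.β * g.α * techExp pm (fun ω => g.ret ω ^ 2) - g.β * w * M)
    + g.β * w * M

theorem IsAdmissible.output_eq {g : Game} (hg : g.IsAdmissible) {s : Profile 2}
    (hs : g.IsEquilibrium s) (pm : ℝ) {x y : ℝ} (hx : x ∈ Set.Icc (0 : ℝ) 1)
    (hy : y ∈ Set.Icc (0 : ℝ) 1) : g.output s pm ![x, y] = g.teamOutput pm x y := by
  have hp : ![x, y] ∈ beliefs 2 := Fin.forall_fin_two.2 ⟨hx, hy⟩
  have hH := fun i => hg.second_eq hs i (posterior_mem_beliefs hp .high true)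
  have hL := fun i => hg.second_eq hs i (posterior_mem_beliefs hp .low true)
  have hle := hg.sum_successGain_le hp
  have hE : ∑ i, g.successGain ![x, y] i = g.teamEffort x y := by
    simp [Fin.sum_univ_two, successGain, teamEffort, IsAdmissible.meanRet_eq, techExp]
    ring
  have hfirst : ∑ i, s.first i ![x, y] = g.teamEffort x y :=
    (Finset.sum_congr rfl fun i _ => hg.first_eq hs i hp).trans hE
  simp only [posterior, meanRet_one, meanRet_zero] at hH hL
  simp only [output, outcomeExp, Finset.sum_add_distrib, hfirst]
  rw [succProb, min_eq_left (hE ▸ hle)]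
  simp only [techExp, posterior, Fin.sum_univ_two, hH, hL, hg.second_eq hs _ hp, teamOutput,
    IsAdmissible.meanRet_eq, Matrix.cons_val_zero, Matrix.cons_val_one]
  simp only [memberRet]
  ring

theorem continuous_teamOutput (g : Game) (pm : ℝ) :
    Continuous fun z : ℝ × ℝ => g.teamOutput pm z.1 z.2 := by
  unfold teamOutput teamEffort
  fun_prop

/-- The loss in the output of a team whose total optimism is `S` instead of `1`. -/
noncomputable def mismatchLoss (g : Game) (pm S : ℝ) : ℝ :=
  let Δ := g.memberRet .high - g.memberRet .low
  let w := techExp pm g.ret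
  (S - 1) ^ 2 * (g.β * Δ ^ 2 *
    (2 * w + 2 * g.β * g.α * techExp pm (fun ω => g.ret ω ^ 2) - 2 * g.β * w * g.memberRet .low
      + 3 / 2 * w * g.β * Δ - 5 / 6 * g.β * Δ * w * (S + 2)))

/-- A dual potential for the matching problem. -/
noncomputable def potential (g : Game) (pm x : ℝ) : ℝ :=
  (g.teamOutput pm x x + g.mismatchLoss pm (2 * x)) / 2

theorem continuous_potential (g : Game) (pm : ℝ) : Continuous (g.potential pm) := by
  unfold potential teamOutput teamEffort mismatchLoss
  fun_prop

theorem teamOutput_eq_potential (g : Game) (pm x y : ℝ) :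
    g.teamOutput pm x y = g.potential pm x + g.potential pm y - g.mismatchLoss pm (x + y) := by
  simp only [potential, teamOutput, teamEffort, mismatchLoss]
  ring

theorem mismatchLoss_one (g : Game) (pm : ℝ) : g.mismatchLoss pm 1 = 0 := by
  simp [mismatchLoss]

theorem IsAdmissible.techExp_ret_pos {g : Game} (hg : g.IsAdmissible) {pm : ℝ}
    (hpm : pm ∈ Set.Icc (0 : ℝ) 1) : 0 < techExp pm g.ret :=
  pos_of_mul_pos_right (hg.meanRet_pos hpm) hg.share_pos.le

theorem IsAdmissible.mismatchLoss_nonneg {g : Game} (hg : g.IsAdmissible) {pm S : ℝ}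
    (hpm : pm ∈ Set.Icc (0 : ℝ) 1) (hS : S ≤ 2) : 0 ≤ g.mismatchLoss pm S := by
  have hw := hg.techExp_ret_pos hpm
  have hq : 0 ≤ techExp pm (fun ω => g.ret ω ^ 2) :=
    add_nonneg (mul_nonneg hpm.1 (sq_nonneg _)) (mul_nonneg (sub_nonneg.2 hpm.2) (sq_nonneg _))
  have hb := hg.discount_pos
  have hb1 := hg.discount_le_one
  have h0 := hg.memberRet_low_pos
  have h1 := hg.memberRet_low_lt_high
  have h2 := hg.memberRet_high_lt
  simp only [mismatchLoss]
  set w := techExp pm g.ret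
  set v := techExp pm (fun ω => g.ret ω ^ 2)
  obtain ⟨D, hD⟩ : ∃ D, D = g.memberRet .high - g.memberRet .low := ⟨_, rfl⟩
  rw [← hD]
  have hv : 0 ≤ g.β * g.α * v := mul_nonneg (mul_nonneg hb.le hg.share_pos.le) hq
  have hD0 : 0 ≤ g.β * D := mul_nonneg hb.le (by linarith)
  have hβD : g.β * D ≤ D := by nlinarith
  have hβr : g.β * g.memberRet .low ≤ g.memberRet .low := by nlinarith
  have hS' := mul_le_mul_of_nonneg_left (show S + 2 ≤ 4 by linarith) hD0
  -- The worst case S = 2 leaves 2 − 2β·low − (11/6)βΔ, which is positive because low + Δ = high <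
  -- 1/4.
  have hfac : 0 ≤ 2 - 2 * (g.β * g.memberRet .low) + 3 / 2 * (g.β * D)
      - 5 / 6 * (g.β * D * (S + 2)) := by linarith
  have hwf := mul_nonneg hw.le hfac
  refine mul_nonneg (sq_nonneg _) (mul_nonneg (mul_nonneg hb.le (sq_nonneg _)) ?_)
  nlinarith

theorem IsAdmissible.dividendCoeff_pos {g : Game} (hg : g.IsAdmissible) {pm : ℝ}
    (hpm : pm ∈ Set.Icc (0 : ℝ) 1) : 0 < g.dividendCoeff 2 (1 / 2) pm := by
  have hmean : ∀ q, techExp q g.memberRet = g.meanRet q := fun q => by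
    simp only [meanRet, techExp, memberRet]; ring
  have hhalf : (1 / 2 : ℝ) ∈ Set.Icc (0 : ℝ) 1 := by norm_num
  have hm := hg.meanRet_pos hpm
  have ho := hg.meanRet_lt hhalf
  have ho0 := hg.meanRet_pos hhalf
  have hb := hg.discount_pos
  have hb1 := hg.discount_le_one
  have hα := hg.share_pos
  simp only [dividendCoeff, hmean]
  have hv : 0 ≤ techExp pm (fun ω => (g.memberRet ω - g.meanRet pm) ^ 2) :=
    add_nonneg (mul_nonneg hpm.1 (sq_nonneg _)) (mul_nonneg (sub_nonneg.2 hpm.2) (sq_nonneg _))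
  have hΔ := sub_pos.2 hg.memberRet_low_lt_high
  refine mul_pos ?_ ?_
  -- The only negative term, −2β·m·E_{1/2}[ω̃], is then smaller in size than m/2.
  · have h1 : g.β * g.meanRet (1 / 2) < 1 / 4 := by nlinarith
    have h2 := mul_lt_mul_of_pos_left h1 hm
    have h3 := mul_nonneg hb.le (sq_nonneg (g.meanRet pm))
    have h4 := mul_nonneg hb.le hv
    push_cast
    nlinarith
  · push_cast
    norm_num
    positivity

/-- The output of a balanced team, as a function of the disagreement between its members. -/
theorem IsAdmissible.teamOutput_balanced {g : Game} (hg : g.IsAdmissible) (pm : ℝ) :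
    ∃ c, ∀ x, g.teamOutput pm x (1 - x) =
      c + 4 * g.dividendCoeff 2 (1 / 2) pm * (x ^ 2 - x) := by
  -- The constant is the value at x = 0, where x² − x vanishes.
  refine ⟨g.teamOutput pm 0 1, fun x => ?_⟩
  have hα := hg.share_pos.ne'
  simp only [dividendCoeff, teamOutput, teamEffort, techExp, memberRet]
  push_cast
  field_simp
  ring

end Game

/-! ### Symmetric workforces and the reflection plan -/

namespace IsSymmetricWorkforce

variable {F : Measure ℝ}

theorem ae_mem_Icc (hF : IsSymmetricWorkforce F) : ∀ᵐ p ∂F, p ∈ Set.Icc (0 : ℝ) 1 :=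
  hF.support_eq ▸ Measure.support_mem_ae

theorem integrable (hF : IsSymmetricWorkforce F) {f : ℝ → ℝ} (hf : Continuous f) :
    Integrable f F := by
  have := hF.prob
  obtain ⟨C, hC⟩ := isCompact_Icc.exists_bound_of_continuousOn
    (s := Set.Icc (0 : ℝ) 1) hf.continuousOn
  exact Integrable.of_bound hf.aestronglyMeasurable C (hF.ae_mem_Icc.mono hC)

theorem integral_reflect (hF : IsSymmetricWorkforce F) (f : ℝ → ℝ) (hf : Continuous f) :
    ∫ p, f (1 - p) ∂F = ∫ p, f p ∂F := by
  conv_rhs => rw [← hF.symmetric]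
  exact (integral_map (by fun_prop) hf.aestronglyMeasurable).symm

theorem integral_id (hF : IsSymmetricWorkforce F) : ∫ p, p ∂F = 1 / 2 := by
  have := hF.prob
  have h := hF.integral_reflect (fun p => p) continuous_id
  have h1 : Integrable (fun p : ℝ => p) F := hF.integrable continuous_id
  rw [integral_sub (integrable_const _) h1] at h
  simp at h
  linarith

theorem measure_singleton (hF : IsSymmetricWorkforce F) (x : ℝ) : F {x} = 0 := by
  have := hF.prob
  rw [← ProbabilityTheory.measure_cdf F, StieltjesFunction.measure_singleton,
    hF.continuous_cdf.continuousAt.continuousWithinAt.leftLim_eq, sub_self,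
    ENNReal.ofReal_zero]

/-- Reflection turns the upper tail into a lower one; the endpoint is negligible because there are
no atoms. -/
theorem cdf_one_sub (hF : IsSymmetricWorkforce F) (p : ℝ) :
    1 - ProbabilityTheory.cdf F p = ProbabilityTheory.cdf F (1 - p) := by
  have := hF.prob
  have : NullSingletonClass F := ⟨hF.measure_singleton⟩
  rw [ProbabilityTheory.cdf_eq_real, ProbabilityTheory.cdf_eq_real,
    ← probReal_compl_eq_one_sub measurableSet_Iic, Set.compl_Iic, measureReal_congr Ioi_ae_eq_Ici]
  conv_rhs => rw [← hF.symmetric, measureReal_def, Measure.map_apply (by fun_prop) measurableSet_Iic]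
  rw [measureReal_def]
  congr 2
  ext x
  simp

/-- Full support gives mass to a neighbourhood of every midpoint. -/
theorem cdf_strictMonoOn (hF : IsSymmetricWorkforce F) :
    StrictMonoOn (ProbabilityTheory.cdf F) (Set.Icc 0 1) := by
  have := hF.prob
  intro x hx y hy hxy
  have hmem : (x + y) / 2 ∈ F.support := by
    rw [hF.support_eq]
    constructor <;> linarith [hx.1, hx.2, hy.1, hy.2]
  have hpos := Measure.mem_support_iff_forall _ |>.1 hmem _
    (Ioc_mem_nhds (a := x) (b := y) (by linarith) (by linarith))
  rw [← ProbabilityTheory.measure_cdf F, StieltjesFunction.measure_Ioc, ENNReal.ofReal_pos] at hpos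
  linarith

theorem plan_eq (hF : IsSymmetricWorkforce F) {p : ℝ} (hp : p ∈ Set.Icc (0 : ℝ) 1) :
    plan F p = 1 - p := by
  have hp' : 1 - p ∈ Set.Icc (0 : ℝ) 1 := ⟨by linarith [hp.2], by linarith [hp.1]⟩
  rw [plan, quantile, hF.cdf_one_sub]
  exact IsLeast.csInf_eq ⟨⟨hp', le_rfl⟩, fun x hx => (hF.cdf_strictMonoOn.le_iff_le hp' hx.1).1 hx.2⟩

theorem workforceDisagreement_eq (hF : IsSymmetricWorkforce F) :
    workforceDisagreement F = 2 * ∫ p, p ^ 2 ∂F - 1 / 2 := by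
  have := hF.prob
  have h1 := hF.integrable continuous_id
  have h2 := hF.integrable (continuous_pow 2)
  have hmul : Integrable (fun z : ℝ × ℝ => z.1 * z.2) (F.prod F) := h1.mul_prod h1
  have hfst : Integrable (fun z : ℝ × ℝ => z.1 ^ 2) (F.prod F) := h2.comp_fst F
  have hsnd : Integrable (fun z : ℝ × ℝ => z.2 ^ 2) (F.prod F) := h2.comp_snd F
  have e : ∀ z : ℝ × ℝ, (z.1 - z.2) ^ 2 = z.1 ^ 2 + z.2 ^ 2 - 2 * (z.1 * z.2) := fun z => by ring
  rw [workforceDisagreement]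
  simp_rw [e]
  have hadd : Integrable (fun z : ℝ × ℝ => z.1 ^ 2 + z.2 ^ 2) (F.prod F) := hfst.add hsnd
  rw [integral_sub hadd (hmul.const_mul 2), integral_add hfst hsnd, integral_const_mul,
    integral_prod_mul (fun x : ℝ => x) (fun y : ℝ => y), hF.integral_id,
    integral_fun_fst (fun x : ℝ => x ^ 2), integral_fun_snd (fun x : ℝ => x ^ 2)]
  simp
  ring

/-! ### Optimality and value of the reflection plan -/

section Value

variable {g : Game} {s : Profile 2} {pm : ℝ}

theorem workforceValue_eq_teamOutput (hF : IsSymmetricWorkforce F) (hg : g.IsAdmissible)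
    (hs : g.IsEquilibrium s) :
    g.workforceValue s pm F = 1 / 2 * ∫ p, g.teamOutput pm p (1 - p) ∂F := by
  rw [Game.workforceValue]
  congr 1
  refine integral_congr_ae (hF.ae_mem_Icc.mono fun p hp => ?_)
  simp only [hF.plan_eq hp]
  exact hg.output_eq hs pm hp ⟨by linarith [hp.2], by linarith [hp.1]⟩

/-- The reflection plan has zero mismatch loss, so its value equals the dual bound. -/
theorem workforceValue_eq_potential (hF : IsSymmetricWorkforce F) (hg : g.IsAdmissible)
    (hs : g.IsEquilibrium s) :
    g.workforceValue s pm F = ∫ p, g.potential pm p ∂F := by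
  have hc := g.continuous_potential pm
  have e : ∀ p, g.teamOutput pm p (1 - p) = g.potential pm p + g.potential pm (1 - p) := fun p => by
    rw [g.teamOutput_eq_potential, add_sub_cancel, g.mismatchLoss_one, sub_zero]
  rw [hF.workforceValue_eq_teamOutput hg hs]
  simp_rw [e]
  have hc' : Continuous fun p => g.potential pm (1 - p) := hc.comp (by fun_prop)
  rw [integral_add (hF.integrable hc) (hF.integrable hc'),
    hF.integral_reflect _ hc]
  ring

/-- The constant does not depend on F, so it cancels when workforces are compared. -/
theorem workforceValue_eq_disagreement (hg : g.IsAdmissible) (hs : g.IsEquilibrium s) :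
    ∃ c, ∀ F, IsSymmetricWorkforce F → g.workforceValue s pm F =
      c + g.dividendCoeff 2 (1 / 2) pm * workforceDisagreement F := by
  obtain ⟨c, hc⟩ := hg.teamOutput_balanced pm
  refine ⟨c / 2 - g.dividendCoeff 2 (1 / 2) pm / 2, fun F hF => ?_⟩
  have := hF.prob
  have h1 : Integrable (fun p : ℝ => p) F := hF.integrable continuous_id
  have h2 := hF.integrable (continuous_pow 2)
  rw [hF.workforceValue_eq_teamOutput hg hs, hF.workforceDisagreement_eq]
  simp_rw [hc]
  have h3 : Integrable (fun p : ℝ => p ^ 2 - p) F := h2.sub h1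
  rw [integral_add (integrable_const _) (h3.const_mul _), integral_const_mul,
    integral_sub h2 h1, hF.integral_id]
  simp
  ring

theorem workforceValue_isGreatest (hF : IsSymmetricWorkforce F) (hg : g.IsAdmissible)
    (hs : g.IsEquilibrium s) (hpm : pm ∈ Set.Icc (0 : ℝ) 1) :
    IsGreatest (g.matchingOutput s pm '' couplings F) (g.workforceValue s pm F) := by
  have := hF.prob
  have hc := g.continuous_potential pm
  have houtput : ∀ γ ∈ couplings F, IsProbabilityMeasure γ ∧ (∀ᵐ z ∂γ, z.1 ∈ Set.Icc (0 : ℝ) 1 ∧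
      z.2 ∈ Set.Icc (0 : ℝ) 1) ∧
      g.matchingOutput s pm γ = 1 / 2 * ∫ z, g.teamOutput pm z.1 z.2 ∂γ := by
    rintro γ ⟨hγ, h1, h2⟩
    have hmem : ∀ᵐ z ∂γ, z.1 ∈ Set.Icc (0 : ℝ) 1 ∧ z.2 ∈ Set.Icc (0 : ℝ) 1 :=
      (ae_of_ae_map measurable_fst.aemeasurable (h1 ▸ hF.ae_mem_Icc)).and
        (ae_of_ae_map measurable_snd.aemeasurable (h2 ▸ hF.ae_mem_Icc))
    refine ⟨hγ, hmem, ?_⟩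
    rw [Game.matchingOutput]
    congr 1
    exact integral_congr_ae (hmem.mono fun z hz => hg.output_eq hs pm hz.1 hz.2)
  constructor
  · have hmeas : Measurable fun p : ℝ => (p, 1 - p) := by fun_prop
    have hγ : F.map (fun p => (p, 1 - p)) ∈ couplings F := by
      refine ⟨Measure.isProbabilityMeasure_map hmeas.aemeasurable, ?_, ?_⟩
      · rw [Measure.map_map measurable_fst hmeas]
        exact Measure.map_id
      · rw [Measure.map_map measurable_snd hmeas]
        exact hF.symmetric
    refine ⟨_, hγ, ?_⟩
    rw [(houtput _ hγ).2.2, hF.workforceValue_eq_teamOutput hg hs,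
      integral_map hmeas.aemeasurable (g.continuous_teamOutput pm).aestronglyMeasurable]
  · rintro _ ⟨γ, hγ, rfl⟩
    obtain ⟨hprob, hmem, heq⟩ := houtput γ hγ
    obtain ⟨-, h1, h2⟩ := hγ
    have i1 : Integrable (fun z : ℝ × ℝ => g.potential pm z.1) γ :=
      Integrable.comp_measurable (g := g.potential pm) (h1.symm ▸ hF.integrable hc) measurable_fst
    have i2 : Integrable (fun z : ℝ × ℝ => g.potential pm z.2) γ :=
      Integrable.comp_measurable (g := g.potential pm) (h2.symm ▸ hF.integrable hc) measurable_snd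
    have e1 : ∫ z, g.potential pm z.1 ∂γ = ∫ p, g.potential pm p ∂F := by
      rw [← integral_map measurable_fst.aemeasurable hc.aestronglyMeasurable, h1]
    have e2 : ∫ z, g.potential pm z.2 ∂γ = ∫ p, g.potential pm p ∂F := by
      rw [← integral_map measurable_snd.aemeasurable hc.aestronglyMeasurable, h2]
    obtain ⟨C, hC⟩ := (isCompact_Icc.prod isCompact_Icc).exists_bound_of_continuousOn
      (s := Set.Icc (0 : ℝ) 1 ×ˢ Set.Icc (0 : ℝ) 1) (g.continuous_teamOutput pm).continuousOn
    have hint : Integrable (fun z : ℝ × ℝ => g.teamOutput pm z.1 z.2) γ :=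
      Integrable.of_bound (g.continuous_teamOutput pm).aestronglyMeasurable C
        (hmem.mono fun z hz => hC z ⟨hz.1, hz.2⟩)
    -- Weak duality: dropping the nonnegative loss leaves a bound that depends only on the
    -- marginals.
    have hle := integral_mono_ae hint (i1.add i2) (hmem.mono fun z hz => by
      have := hg.mismatchLoss_nonneg hpm (S := z.1 + z.2) (by linarith [hz.1.2, hz.2.2])
      simp only [Pi.add_apply]
      rw [g.teamOutput_eq_potential]
      linarith)
    rw [integral_add' i1 i2, e1, e2] at hle
    rw [heq, hF.workforceValue_eq_potential hg hs]
    linarith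

end Value

end IsSymmetricWorkforce

end TeamProduction

theorem proposition4 (g : TeamProduction.Game)
    (hr : 0 < g.r) (hrR : g.r < g.R)
    (hα : 0 < g.α) (hα1 : g.α ≤ 1) (hβ : 0 < g.β) (hβ1 : g.β ≤ 1)
    (hbound : 2 * 2 * g.R < 1)
    (pm : ℝ) (hpm : pm ∈ Set.Icc (0 : ℝ) 1) :
    (∃ s : TeamProduction.Profile 2, g.IsEquilibrium s) ∧
    0 < g.dividendCoeff 2 (1 / 2) pm ∧
    ∀ s : TeamProduction.Profile 2, g.IsEquilibrium s →
      (∀ F : MeasureTheory.Measure ℝ, TeamProduction.IsSymmetricWorkforce F →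
        IsGreatest (g.matchingOutput s pm '' TeamProduction.couplings F)
          (g.workforceValue s pm F)) ∧
      ∀ F G : MeasureTheory.Measure ℝ,
        TeamProduction.IsSymmetricWorkforce F → TeamProduction.IsSymmetricWorkforce G →
        g.workforceValue s pm F - g.workforceValue s pm G =
          g.dividendCoeff 2 (1 / 2) pm *
            (TeamProduction.workforceDisagreement F - TeamProduction.workforceDisagreement G) ∧
        (g.workforceValue s pm F > g.workforceValue s pm G ↔
          TeamProduction.workforceDisagreement F > TeamProduction.workforceDisagreement G) := by
  have hg : g.IsAdmissible := ⟨hr, hrR, hα, hα1, hβ, hβ1, hbound⟩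
  have hκ := hg.dividendCoeff_pos hpm
  refine ⟨⟨_, hg.isEquilibrium_marginalProfile⟩, hκ, fun s hs =>
    ⟨fun F hF => hF.workforceValue_isGreatest hg hs hpm, fun F G hF hG => ?_⟩⟩
  obtain ⟨c, hc⟩ :=
    TeamProduction.IsSymmetricWorkforce.workforceValue_eq_disagreement (pm := pm) hg hs
  rw [hc F hF, hc G hG]
  exact ⟨by ring, by rw [gt_iff_lt, add_lt_add_iff_left, mul_lt_mul_iff_right₀ hκ]⟩
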